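/- Let $K$ be a field of characteristic zero and let $\mathcal A$ be a commutative (associative, not necessarily unital) $K$-algebra. A $K$-linear map $\eta:\mathcal A\to\mathcal A$ is called locally nilpotent if for every $a\in\mathcal A$ there is $m\ge 1$ with $\eta^m(a)=0$, and locally finite if for every $a\in\mathcal A$ the $K$-subspace spanned by $\{\eta^i(a): i\ge 0\}$ is finite dimensional. A $K$-derivation of $\mathcal A$ is a $K$-linear map $D:\mathcal A\to\mathcal A$ with $D(ab)=D(a)b+aD(b)$ for all $a,b\in\mathcal A$, and a $K$-$\mathcal E$-derivation of $\mathcal A$ is a $K$-linear map $\delta:\mathcal A\to\mathcal A$ with $\delta(ab)=\delta(a)b+a\delta(b)-\delta(a)\delta(b)$ for all $a,b\in\mathcal A$. Let $\delta$ be a locally finite $K$-derivation of $\mathcal A$ or a locally nilpotent $K$-$\mathcal E$-derivation of $\mathcal A$, and let $e\in\operatorname{Im}\delta:=\delta(\mathcal A)$ be an idempotent, i.e. $e^2=e$. Then the principal ideal $(e)$ of $\mathcal A$ generated by $e$ is contained in $\operatorname{Im}\delta$. -/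

import Mathlib

section Endomorphisms

variable {K V : Type*} [Field K] [AddCommGroup V] [Module K V]

/-- A linear endomorphism `η` is locally nilpotent if every vector is killed by a positive power
of `η`. -/
def IsLocallyNilpotentEnd (η : V →ₗ[K] V) : Prop :=
  ∀ a : V, ∃ m : ℕ, 1 ≤ m ∧ (η ^ m) a = 0

/-- A linear endomorphism `η` is locally finite if, for every vector `a`, the subspace spanned by
`a, η a, η² a, …` is finite dimensional. -/
def IsLocallyFiniteEnd (η : V →ₗ[K] V) : Prop :=
  ∀ a : V, FiniteDimensional K (Submodule.span K (Set.range fun i : ℕ => (η ^ i) a))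

end Endomorphisms

section Derivations

variable {K A : Type*} [Field K] [NonUnitalRing A] [Module K A]

/-- `D` is a `K`-derivation of the (not necessarily unital or commutative) algebra `A`. -/
def IsKDerivation (D : A →ₗ[K] A) : Prop :=
  ∀ a b : A, D (a * b) = D a * b + a * D b

/-- `δ` is a `K`-`ℰ`-derivation of the (not necessarily unital or commutative) algebra `A`. -/
def IsEDerivation (δ : A →ₗ[K] A) : Prop :=
  ∀ a b : A, δ (a * b) = δ a * b + a * δ b - δ a * δ b

end Derivations

/-!
In both cases `δ e = 0`. A derivation satisfies `δ e = 2 e δ(e)`, which forces `δ e = 0`. If `δ` is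
an `ℰ`-derivation, then `φ = 1 - δ` is multiplicative, and local nilpotency makes
`k ↦ φ ^ k (e) = ∑ j, (k choose j) (-δ) ^ j (e)` a polynomial whose values are idempotent. In
characteristic zero such a polynomial is itself idempotent, so its derivative vanishes by the first
case and it is constant; comparing `k = 0` and `k = 1` gives `δ e = 0`.

Now let `e = δ s`. The divided falling factorial powers of `s` form a sequence of iterated
antiderivatives of `e`, and integrating by parts repeatedly shows `e b ∈ Im δ` whenever some power
of `δ` kills `b`. Under a locally finite derivation every `b` is the sum of such an element and some
`δ y`, and `e δ(y) = δ(e y)`.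
-/

open Polynomial

section PolynomialsOnNaturals

variable {R : Type*} [CommRing R]

theorem polynomial_eq_zero_of_eval_natCast_eq_zero [IsAddTorsionFree R] {p : R[X]}
    (hp : ∀ k : ℕ, p.eval (k : R) = 0) : p = 0 := by
  have hcoeff : p.coeff 0 = 0 := by simpa only [coeff_zero_eq_eval_zero, Nat.cast_zero] using hp 0
  induction hn : p.natDegree generalizing p with
  | zero => rw [eq_C_of_natDegree_eq_zero hn, hcoeff, C_0]
  | succ n ih =>
    have hX : X * p.divX = p := by simpa [hcoeff] using p.X_mul_divX_add
    have hshift (k : ℕ) : (taylor 1 p.divX).eval (k : R) = 0 := by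
      have hk : (k + 1) • p.divX.eval ((k : R) + 1) = 0 := by
        have := hp (k + 1)
        rw [← hX] at this
        simpa using this
      simpa [taylor_eval, add_comm] using (smul_eq_zero_iff_right k.succ_ne_zero).mp hk
    have hdivX : taylor 1 p.divX = 0 := by
      refine ih hshift (by simpa [coeff_zero_eq_eval_zero] using hshift 0) ?_
      rw [natDegree_taylor, natDegree_divX_eq_natDegree_tsub_one, hn, Nat.add_sub_cancel]
    rw [← hX, taylor_injective 1 (hdivX.trans (map_zero _).symm), mul_zero]

theorem exists_polynomial_eval_natCast_eq_sum_choose [Algebra ℚ R] (a : ℕ → R) (n : ℕ) :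
    ∃ p : R[X], ∀ k : ℕ, p.eval (k : R) = ∑ j ∈ Finset.range n, k.choose j • a j := by
  refine ⟨∑ j ∈ Finset.range n, C ((j.factorial : ℚ)⁻¹ • a j) * descPochhammer R j, fun k => ?_⟩
  rw [eval_finsetSum]
  refine Finset.sum_congr rfl fun j _ => ?_
  have hj : (j.factorial : ℚ) ≠ 0 := Nat.cast_ne_zero.mpr j.factorial_ne_zero
  calc (C ((j.factorial : ℚ)⁻¹ • a j) * descPochhammer R j).eval (k : R)
      = (j.factorial : ℚ)⁻¹ • j.factorial • k.choose j • a j := by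
        rw [eval_C_mul, descPochhammer_eval_eq_descFactorial,
          Nat.descFactorial_eq_factorial_mul_choose, smul_mul_assoc, mul_comm, ← nsmul_eq_mul,
          mul_smul]
    _ = k.choose j • a j := by rw [← Nat.cast_smul_eq_nsmul ℚ j.factorial, inv_smul_smul₀ hj]

end PolynomialsOnNaturals

theorem one_add_pow_apply_eq_sum_choose {S V : Type*} [Semiring S] [AddCommMonoid V] [Module S V]
    {η : Module.End S V} {v : V} {n : ℕ} (hn : (η ^ n) v = 0) (k : ℕ) :
    ((1 + η) ^ k) v = ∑ j ∈ Finset.range n, k.choose j • (η ^ j) v := by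
  have hbinom : ((1 + η) ^ k) v = ∑ j ∈ Finset.range (k + 1), k.choose j • (η ^ j) v := by
    rw [add_comm, (Commute.one_right η).add_pow, LinearMap.sum_apply]
    simp
  have hlarge {j : ℕ} (hj : n ≤ j) : (η ^ j) v = 0 := by
    rw [← Nat.sub_add_cancel hj, pow_add, Module.End.mul_apply, hn, map_zero]
  rw [hbinom]
  trans ∑ j ∈ Finset.range (k + 1 + n), k.choose j • (η ^ j) v
  · refine Finset.sum_subset (Finset.range_mono (Nat.le_add_right _ _)) fun j _ hj => ?_
    rw [Nat.choose_eq_zero_of_lt (by simpa using hj), zero_smul]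
  · refine (Finset.sum_subset (Finset.range_mono (Nat.le_add_left _ _)) fun j _ hj => ?_).symm
    rw [hlarge (by simpa using hj), smul_zero]

section ConstantIdempotents

theorem IsKDerivation.apply_eq_zero_of_isIdempotentElem {K A : Type*} [Field K]
    [NonUnitalCommRing A] [Module K A] {D : A →ₗ[K] A} (hD : IsKDerivation D) {e : A}
    (he : IsIdempotentElem e) : D e = 0 := by
  have hDe : D e = e * D e + e * D e := by
    conv_lhs => rw [← he.eq, hD, mul_comm]
  have heDe : e * D e = 0 := by
    have := congrArg (e * ·) hDe
    simpa only [mul_add, ← mul_assoc, he.eq, left_eq_add] using this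
  rw [hDe, heDe, add_zero]

theorem eval_one_eq_eval_zero_of_isIdempotentElem_eval_natCast {R : Type*} [CommRing R]
    [Algebra ℚ R] {p : R[X]} (hp : ∀ k : ℕ, IsIdempotentElem (p.eval (k : R))) :
    p.eval 1 = p.eval 0 := by
  have : IsAddTorsionFree R := .of_module_rat R
  have hidem : IsIdempotentElem p := sub_eq_zero.mp <|
    polynomial_eq_zero_of_eval_natCast_eq_zero fun k => by
      rw [eval_sub, eval_mul, (hp k).eq, sub_self]
  have hder : IsKDerivation (derivative.restrictScalars ℚ : R[X] →ₗ[ℚ] R[X]) :=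
    fun _ _ => derivative_mul
  rw [eq_C_of_derivative_eq_zero (hder.apply_eq_zero_of_isIdempotentElem hidem), eval_C, eval_C]

theorem IsEDerivation.isIdempotentElem_one_sub_pow_apply {K A : Type*} [Field K] [NonUnitalRing A]
    [Module K A] {δ : Module.End K A} (hδ : IsEDerivation δ) {e : A} (he : IsIdempotentElem e)
    (k : ℕ) : IsIdempotentElem (((1 - δ) ^ k) e) := by
  have hmul (a b : A) : (1 - δ) (a * b) = (1 - δ) a * (1 - δ) b := by
    simp only [LinearMap.sub_apply, Module.End.one_apply, hδ a b]
    noncomm_ring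
  induction k with
  | zero => exact he
  | succ k ih =>
    rw [pow_succ', Module.End.mul_apply, IsIdempotentElem, ← hmul, ih.eq]

theorem IsEDerivation.apply_eq_zero_of_isIdempotentElem {K A : Type*} [Field K] [CharZero K]
    [NonUnitalCommRing A] [Module K A] [IsScalarTower K A A] [SMulCommClass K A A]
    {δ : Module.End K A} (hδ : IsEDerivation δ) {e : A} (he : IsIdempotentElem e) {n : ℕ}
    (hn : (δ ^ n) e = 0) : δ e = 0 := by
  let R := Unitization K A
  let : Algebra ℚ R := ((algebraMap K R).comp (algebraMap ℚ K)).toAlgebra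
  have hneg : ((-δ) ^ n) e = 0 := by
    rw [neg_pow, Module.End.mul_apply, hn, map_zero]
  obtain ⟨p, hp⟩ : ∃ p : R[X], ∀ k : ℕ, p.eval (k : R) = ((((1 - δ) ^ k) e : A) : R) := by
    obtain ⟨p, hp⟩ := exists_polynomial_eval_natCast_eq_sum_choose
      (fun j => ((((-δ) ^ j) e : A) : R)) n
    refine ⟨p, fun k => ?_⟩
    rw [hp, sub_eq_add_neg, one_add_pow_apply_eq_sum_choose hneg]
    change _ = Unitization.inrHom K K A _
    simp only [map_sum, map_nsmul, Unitization.inrHom_apply]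
  have hidem (k : ℕ) : IsIdempotentElem (p.eval (k : R)) := by
    rw [hp, IsIdempotentElem, ← Unitization.inr_mul,
      (hδ.isIdempotentElem_one_sub_pow_apply he k).eq]
  have hp₁ : p.eval 1 = ((e - δ e : A) : R) := by simpa using hp 1
  have hp₀ : p.eval 0 = (e : R) := by simpa using hp 0
  have hfix : e - δ e = e := Unitization.inr_injective <|
    hp₁.symm.trans <| (eval_one_eq_eval_zero_of_isIdempotentElem_eval_natCast hidem).trans hp₀
  rwa [sub_eq_self] at hfix

end ConstantIdempotents

section DifferentialsOfWeight

/-- `δ` is a differential operator of weight `c` in the sense of Rota–Baxter theory. Weight `0`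
gives the derivations and weight `-1` the `ℰ`-derivations, which allows both to be integrated at
once. -/
def IsDifferentialOfWeight {K A : Type*} [CommRing K] [NonUnitalRing A] [Module K A] (c : K)
    (δ : Module.End K A) : Prop :=
  ∀ a b : A, δ (a * b) = δ a * b + a * δ b + c • (δ a * δ b)

theorem IsKDerivation.isDifferentialOfWeight {K A : Type*} [Field K] [NonUnitalRing A] [Module K A]
    {D : A →ₗ[K] A} (hD : IsKDerivation D) : IsDifferentialOfWeight 0 D := fun a b => by
  rw [hD, zero_smul, add_zero]

theorem IsEDerivation.isDifferentialOfWeight {K A : Type*} [Field K] [NonUnitalRing A] [Module K A]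
    {δ : A →ₗ[K] A} (hδ : IsEDerivation δ) : IsDifferentialOfWeight (-1) δ := fun a b => by
  rw [hδ, neg_one_smul, sub_eq_add_neg]

theorem IsDifferentialOfWeight.mul_mem_range_of_apply_succ_eq {K A : Type*} [CommRing K]
    [NonUnitalRing A] [Module K A] {c : K} {δ : Module.End K A} (hδ : IsDifferentialOfWeight c δ)
    {y : ℕ → A} (hy : ∀ k, δ (y (k + 1)) = y k) {m : ℕ} {b : A} (hb : (δ ^ m) b = 0) (k : ℕ) :
    y k * b ∈ LinearMap.range δ := by
  induction m generalizing b k with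
  | zero =>
    have hb₀ : b = 0 := hb
    rw [hb₀, mul_zero]
    exact zero_mem _
  | succ m ih =>
    have hδb : (δ ^ m) (δ b) = 0 := by rwa [pow_succ] at hb
    have hparts : y k * b = δ (y (k + 1) * b) - y (k + 1) * δ b - c • (y k * δ b) := by
      rw [hδ, hy]
      abel
    rw [hparts]
    exact sub_mem (sub_mem ⟨_, rfl⟩ (ih hδb _)) (Submodule.smul_mem _ _ (ih hδb _))

/-- The divided falling factorial powers `s (s - c) ⋯ (s - (k - 1) c) / k!` of step `c`, where the
idempotent `e` plays the role of the unit. If `δ` has weight `c`, `δ s = e` and `δ e = 0`, they are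
iterated antiderivatives of `e`. -/
def dividedFalling {K A : Type*} [Field K] [NonUnitalRing A] [Module K A] (c : K) (e s : A) : ℕ → A
  | 0 => e
  | k + 1 => ((k : K) + 1)⁻¹ •
      (s * dividedFalling c e s k - (c * k) • dividedFalling c e s k)

theorem succ_smul_dividedFalling_succ {K A : Type*} [Field K] [CharZero K] [NonUnitalRing A]
    [Module K A] (c : K) (e s : A) (k : ℕ) :
    ((k : K) + 1) • dividedFalling c e s (k + 1) =
      s * dividedFalling c e s k - (c * k) • dividedFalling c e s k := by
  rw [dividedFalling, smul_inv_smul₀ (Nat.cast_add_one_ne_zero k)]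

section DividedFalling

variable {K A : Type*} [Field K] [NonUnitalCommRing A] [Module K A] [SMulCommClass K A A]

theorem mul_dividedFalling (c : K) {e : A} (he : IsIdempotentElem e) (s : A) (k : ℕ) :
    e * dividedFalling c e s k = dividedFalling c e s k := by
  induction k with
  | zero => exact he
  | succ k ih => rw [dividedFalling, mul_smul_comm, mul_sub, mul_left_comm, mul_smul_comm, ih]

variable [CharZero K] {c : K} {δ : Module.End K A}

theorem IsDifferentialOfWeight.apply_dividedFalling_succ (hδ : IsDifferentialOfWeight c δ) {e s : A}
    (he : IsIdempotentElem e) (hδe : δ e = 0) (hs : δ s = e) (k : ℕ) :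
    δ (dividedFalling c e s (k + 1)) = dividedFalling c e s k := by
  have hδs (y : A) : δ (s * y) = e * y + s * δ y + c • (e * δ y) := by rw [hδ, hs]
  induction k with
  | zero => simp [dividedFalling, hδs, hδe, he.eq]
  | succ k ih =>
    have hk : s * dividedFalling c e s k =
        ((k : K) + 1) • dividedFalling c e s (k + 1) + (c * k) • dividedFalling c e s k :=
      sub_eq_iff_eq_add.mp (succ_smul_dividedFalling_succ c e s k).symm
    refine smul_right_injective A (Nat.cast_add_one_ne_zero (R := K) (k + 1)) ?_
    dsimp only
    rw [← map_smul, succ_smul_dividedFalling_succ, map_sub, map_smul, hδs, ih,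
      mul_dividedFalling c he, mul_dividedFalling c he, hk, Nat.cast_add_one]
    module

theorem IsDifferentialOfWeight.mul_mem_range_of_pow_apply_eq_zero (hδ : IsDifferentialOfWeight c δ)
    {e : A} (he : IsIdempotentElem e) (hδe : δ e = 0) (hmem : e ∈ LinearMap.range δ) {m : ℕ} {b : A}
    (hb : (δ ^ m) b = 0) : e * b ∈ LinearMap.range δ := by
  obtain ⟨s, hs⟩ := hmem
  exact hδ.mul_mem_range_of_apply_succ_eq (hδ.apply_dividedFalling_succ he hδe hs) hb 0

end DividedFalling

end DifferentialsOfWeight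

section LocallyFinite

variable {K V : Type*} [Field K] [AddCommGroup V] [Module K V] {η : V →ₗ[K] V}

theorem IsLocallyFiniteEnd.exists_aeval_apply_eq_zero (hη : IsLocallyFiniteEnd η) (v : V) :
    ∃ p : K[X], p ≠ 0 ∧ aeval η p v = 0 := by
  by_contra! hv
  have hli : LinearIndependent K fun i : ℕ => (η ^ i) v :=
    (linearIndependent_powers_iff_aeval η v).mpr fun p => not_imp_not.mp (hv p)
  have := hη v
  have : Finite ℕ := (linearIndependent_span hli).finite
  exact not_finite ℕ

theorem IsLocallyFiniteEnd.exists_eq_add_apply (hη : IsLocallyFiniteEnd η) (v : V) :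
    ∃ (m : ℕ) (x y : V), (η ^ m) x = 0 ∧ v = x + η y := by
  obtain ⟨p, hp₀, hp⟩ := hη.exists_aeval_apply_eq_zero v
  obtain ⟨q, hpq, hq⟩ := exists_eq_pow_rootMultiplicity_mul_and_not_dvd p hp₀ 0
  rw [C_0, sub_zero] at hpq hq
  have hc : q.coeff 0 ≠ 0 := mt X_dvd_iff.mpr hq
  have hqv : aeval η q v = η (aeval η q.divX v) + q.coeff 0 • v := by
    conv_lhs => rw [← q.X_mul_divX_add, map_add, map_mul, aeval_X, aeval_C]
    rfl
  refine ⟨p.rootMultiplicity 0, (q.coeff 0)⁻¹ • aeval η q v,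
    -((q.coeff 0)⁻¹ • aeval η q.divX v), ?_, ?_⟩
  · rw [hpq, map_mul, map_pow, aeval_X, Module.End.mul_apply] at hp
    rw [map_smul, hp, smul_zero]
  · rw [hqv, smul_add, inv_smul_smul₀ hc, map_neg, map_smul]
    abel

end LocallyFinite

theorem mul_eq_self_of_mem_span_singleton {A : Type*} [NonUnitalCommRing A] {e : A}
    (he : IsIdempotentElem e) {b : A} (hb : b ∈ TwoSidedIdeal.span {e}) : e * b = b := by
  induction hb using TwoSidedIdeal.span_induction with
  | mem x hx => rw [Set.mem_singleton_iff.mp hx, he.eq]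
  | zero => rw [mul_zero]
  | add x y _ _ hx hy => rw [mul_add, hx, hy]
  | neg x _ hx => rw [mul_neg, hx]
  | left_absorb a x _ hx => rw [mul_left_comm, hx]
  | right_absorb a x _ hx => rw [← mul_assoc, hx]

/-- `A` is a commutative, associative, not necessarily unital `K`-algebra, and
`TwoSidedIdeal.span {e}` is the principal ideal generated by `e`. -/
theorem corollary1p3 {K A : Type*} [Field K] [CharZero K] [NonUnitalCommRing A] [Module K A]
    [IsScalarTower K A A] [SMulCommClass K A A] :
    (∀ D : A →ₗ[K] A, IsKDerivation D → IsLocallyFiniteEnd D →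
      ∀ e : A, e ∈ LinearMap.range D → IsIdempotentElem e →
        (TwoSidedIdeal.span {e} : Set A) ⊆ (LinearMap.range D : Set A)) ∧
    (∀ δ : A →ₗ[K] A, IsEDerivation δ → IsLocallyNilpotentEnd δ →
      ∀ e : A, e ∈ LinearMap.range δ → IsIdempotentElem e →
        (TwoSidedIdeal.span {e} : Set A) ⊆ (LinearMap.range δ : Set A)) := by
  refine ⟨fun D hD hfin e hmem he b hb => ?_, fun δ hδ hnil e hmem he b hb => ?_⟩
  · have hDe : D e = 0 := hD.apply_eq_zero_of_isIdempotentElem he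
    obtain ⟨m, x, y, hx, hxy⟩ := hfin.exists_eq_add_apply b
    have hex : e * x ∈ LinearMap.range D :=
      hD.isDifferentialOfWeight.mul_mem_range_of_pow_apply_eq_zero he hDe hmem hx
    have hey : D (e * y) = e * D y := by rw [hD, hDe, zero_mul, zero_add]
    rw [SetLike.mem_coe, ← mul_eq_self_of_mem_span_singleton he hb, hxy, mul_add]
    exact add_mem hex ⟨e * y, hey⟩
  · obtain ⟨n, -, hn⟩ := hnil e
    obtain ⟨m, -, hm⟩ := hnil b
    have hδe : δ e = 0 := hδ.apply_eq_zero_of_isIdempotentElem he hn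
    rw [SetLike.mem_coe, ← mul_eq_self_of_mem_span_singleton he hb]
    exact hδ.isDifferentialOfWeight.mul_mem_range_of_pow_apply_eq_zero he hδe hmem hm
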